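/- **Setting.** Let $\Omega$ be a non-empty finite set and $\Delta(\Omega)$ the set of probability distributions on $\Omega$. At each stage $n\ge 1$ a forecaster predicts $p_n\in\Delta(\Omega)$ and Nature chooses an outcome $\omega_n\in\Omega$. Let $h^n=(p_1,\omega_1,\dots,p_n,\omega_n)$ be the history and $H=\bigcup_{n\ge 0}(\Delta(\Omega)\times\Omega)^n$ the set of finite histories. A deterministic strategy of the forecaster is a map $\sigma:H\to\Delta(\Omega)$, played as $p_{n+1}=\sigma(h^n)$. A strategy of Nature is a map $\tau:H\to\Delta(\Omega)$, where $\tau(h^n)$ is the law of $\omega_{n+1}$ given $h^n$. Let $\mathbb P_{\sigma,\tau}$ be the induced probability on infinite plays. A checking rule independent of current predictions is a pair $(U,T)$ of maps from $H$ to the subsets of $\Omega$ with $T(h)\subset U(h)$ for every $h\in H$. For such a rule put $$N_n[U,T]=\{m\le n:\ \omega_m\in U(h^{m-1})\},\qquad \bar\omega_n[U,T]=\frac{\#\{m\in N_n[U,T]:\ \omega_m\in T(h^{m-1})\}}{|N_n[U,T]|},$$ $$\bar p_n[U,T]=\frac{1}{|N_n[U,T]|}\sum_{m\in N_n[U,T]}p_m\{T(h^{m-1})\mid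 U(h^{m-1})\},$$ with the conventions $0/0=0$ and $p\{A\mid B\}=+\infty$ if $p\{B\}=0$. **Theorem.** Let $\lambda$ be a probability on the set of checking rules independent of current predictions, defined on any $\sigma$-algebra that contains the cylinder $\sigma$-algebra (the one generated by the events $\{x\in U(h)\}$ and $\{x\in T(h)\}$, $h\in H$, $x\in\Omega$). Then there is a deterministic strategy $\sigma$ of the forecaster such that, for every strategy $\tau$ of Nature and for $\lambda$-almost every checking rule $(U,T)$, the following hold $\mathbb P_{\sigma,\tau}$-almost surely: 1. (calibration) $\displaystyle\limsup_{n\to\infty}\frac{|N_n[U,T]|}{n}\,\bigl|\bar\omega_n[U,T]-\bar p_n[U,T]\bigr|\le 0$; 2. if $|N_n[U,T]|\to\infty$, then $\displaystyle\limsup_{n\to\infty}\bigl|\bar\omega_n[U,T]-\bar p_n[U,T]\bigr|\le 0$. (The $\lambda$-null set of exceptional rules may depend on $\tau$.) -/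

import Mathlib

open MeasureTheory ProbabilityTheory Filter
open scoped ENNReal

namespace Calibration

/-- `Forecast Ω` is the set `Δ(Ω)` of probability distributions on the finite set `Ω`. -/
abbrev Forecast (Ω : Type*) [Fintype Ω] : Type _ := stdSimplex ℝ Ω

/-- Finite histories: the set `⋃ n, (Δ(Ω) × Ω) ^ n` of finite sequences of pairs (prediction,
outcome), in chronological order. -/
abbrev History (Ω : Type*) [Fintype Ω] : Type _ := List (Forecast Ω × Ω)

/-- The probability `p(A)` of an event `A` under the forecast `p`. -/
noncomputable def prob {Ω : Type*} [Fintype Ω] (p : Forecast Ω) (A : Set Ω) : ℝ :=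
  ∑ x, A.indicator (fun y => p.1 y) x

open Classical in
/-- The conditional probability `p(A | B)`, with the convention `p(A | B) = +∞` if `p(B) = 0`. -/
noncomputable def condProb {Ω : Type*} [Fintype Ω] (p : Forecast Ω) (A B : Set Ω) : EReal :=
  if prob p B = 0 then ⊤ else ((prob p (A ∩ B) / prob p B : ℝ) : EReal)

/-- A checking rule independent of current predictions: an active universe mapping and a testing
mapping, from finite histories to subsets of `Ω`. -/
structure CheckingRule (Ω : Type*) [Fintype Ω] where
  /-- the active universe `U(h)` -/
  active : History Ω → Set Ω
  /-- the tested event `T(h)` -/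
  tested : History Ω → Set Ω
  tested_subset : ∀ h, tested h ⊆ active h

/-- The cylinder σ-algebra on the set of checking rules: the smallest one for which, for every
finite history `h`, the events `{x ∈ U(h)}` and `{x ∈ T(h)}` are measurable. -/
@[reducible] def cylinderSigmaAlgebra (Ω : Type*) [Fintype Ω] : MeasurableSpace (CheckingRule Ω) :=
  MeasurableSpace.generateFrom
    {S | ∃ (h : History Ω) (x : Ω), S = {R | x ∈ R.active h} ∨ S = {R | x ∈ R.tested h}}

/-- A deterministic strategy of the forecaster. -/
abbrev Forecaster (Ω : Type*) [Fintype Ω] : Type _ := History Ω → Forecast Ω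

/-- A (randomized) strategy of Nature: after each finite history it gives the law of the next
outcome. -/
abbrev Nature (Ω : Type*) [Fintype Ω] : Type _ := History Ω → stdSimplex ℝ Ω

/-- The history of the first `n` stages when the forecaster plays the deterministic strategy `σ`
and the outcome of stage `m + 1` is `x m`. -/
def history {Ω : Type*} [Fintype Ω] (σ : Forecaster Ω) (x : ℕ → Ω) : ℕ → History Ω
  | 0 => []
  | n + 1 => history σ x n ++ [(σ (history σ x n), x n)]

/-- The probability measure on `Ω` given by a point of the simplex. -/
noncomputable def toMeasure {Ω : Type*} [Fintype Ω] [MeasurableSpace Ω] (q : stdSimplex ℝ Ω) :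
    Measure Ω :=
  ∑ x, ENNReal.ofReal (q.1 x) • Measure.dirac x

instance {Ω : Type*} [Fintype Ω] [MeasurableSpace Ω] (q : stdSimplex ℝ Ω) :
    IsProbabilityMeasure (toMeasure q) := by
  constructor
  simp only [toMeasure, Measure.coe_finsetSum, Finset.sum_apply, Measure.smul_apply,
    measure_univ, smul_eq_mul, mul_one]
  rw [← ENNReal.ofReal_sum_of_nonneg (fun x _ => q.2.1 x), q.2.2, ENNReal.ofReal_one]

/-- The law of the next outcome given the outcomes of the stages `1, …, n + 1` (indexed by
`0, …, n`), when the forecaster plays `σ` and Nature plays `τ`. -/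
noncomputable def nextOutcome {Ω : Type*} [Fintype Ω] [MeasurableSpace Ω]
    [MeasurableSingletonClass Ω] (σ : Forecaster Ω) (τ : Nature Ω) (n : ℕ) :
    Kernel (Finset.Iic n → Ω) Ω :=
  Kernel.ofFunOfCountable fun x =>
    toMeasure (τ (history σ (fun k => x ⟨min k n, Finset.mem_Iic.2 (min_le_right k n)⟩) (n + 1)))

instance {Ω : Type*} [Fintype Ω] [MeasurableSpace Ω] [MeasurableSingletonClass Ω]
    (σ : Forecaster Ω) (τ : Nature Ω) (n : ℕ) : IsMarkovKernel (nextOutcome σ τ n) :=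
  ⟨fun x => inferInstanceAs (IsProbabilityMeasure (toMeasure (τ (history σ
    (fun k => x ⟨min k n, Finset.mem_Iic.2 (min_le_right k n)⟩) (n + 1)))))⟩

/-- The probability `P_{σ,τ}` on infinite plays. As `σ` is deterministic, an infinite play is
described by its sequence of outcomes, where `x m` is the outcome of stage `m + 1`. -/
noncomputable def playMeasure {Ω : Type*} [Fintype Ω] [MeasurableSpace Ω]
    [MeasurableSingletonClass Ω] (σ : Forecaster Ω) (τ : Nature Ω) : Measure (ℕ → Ω) :=
  Kernel.trajMeasure (X := fun _ => Ω) (toMeasure (τ [])) (nextOutcome σ τ)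

open Classical in
/-- The set of active stages among the first `n`; stage `m + 1` is represented by `m`. -/
noncomputable def activeStages {Ω : Type*} [Fintype Ω] (σ : Forecaster Ω) (R : CheckingRule Ω)
    (x : ℕ → Ω) (n : ℕ) : Finset ℕ :=
  {m ∈ Finset.range n | x m ∈ R.active (history σ x m)}

open Classical in
/-- The empirical frequency of the tested event over the active stages (`0 / 0 = 0`). -/
noncomputable def empirical {Ω : Type*} [Fintype Ω] (σ : Forecaster Ω) (R : CheckingRule Ω)
    (x : ℕ → Ω) (n : ℕ) : EReal :=
  ((({m ∈ activeStages σ R x n | x m ∈ R.tested (history σ x m)}.card : ℝ) /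
    ((activeStages σ R x n).card : ℝ) : ℝ) : EReal)

/-- The average over the active stages of the predicted conditional probability of the tested
event given the active universe (`0 / 0 = 0`). -/
noncomputable def predicted {Ω : Type*} [Fintype Ω] (σ : Forecaster Ω) (R : CheckingRule Ω)
    (x : ℕ → Ω) (n : ℕ) : EReal :=
  (∑ m ∈ activeStages σ R x n,
      condProb (σ (history σ x m)) (R.tested (history σ x m)) (R.active (history σ x m))) /
    (((activeStages σ R x n).card : ℝ) : EReal)

/-- The gap between the empirical frequency and the average prediction, in `[0, ∞]`. -/
noncomputable def gap {Ω : Type*} [Fintype Ω] (σ : Forecaster Ω) (R : CheckingRule Ω)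
    (x : ℕ → Ω) (n : ℕ) : ℝ≥0∞ :=
  (empirical σ R x n - predicted σ R x n).abs

end Calibration

/-! Attach to each rule its average score `a`, the gap between observed frequency and prediction
over its `N` active stages, and the potential `a ^ 2 + 2 / (N + 1)`. An active stage lowers the
potential by at least `a ^ 2 / (N + 1)`, up to twice a weighted score (`sq_average_step`). The
forecaster cannot control this score rule by rule, but controls its `μ`-average: scores have mean
zero under the forecast itself, so a fixed point argument gives a strictly positive forecast whose
averaged weighted score is at most `2⁻ⁿ`, whatever the outcome (`exists_forecast_sum_score_le`).

Telescoping bounds the `μ`-average of `∑ a ^ 2 / (N + 1)`, taken over active stages, by `7` on every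
outcome sequence. By Tonelli this sum is finite for almost every rule and almost every play,
whatever the law of the plays (`ae_ae_summable_decrease`). A deterministic argument then forces `a →
0` when `N → ∞` (`tendsto_average_of_summable_sq`); when `N` is bounded, the factor `N / n`
suffices. -/

/-! ### Brouwer's theorem for bounded C¹ maps, by a volume argument. -/

section Brouwer

open Metric Set Topology

variable {E : Type*} [NormedAddCommGroup E] [InnerProductSpace ℝ E] [FiniteDimensional ℝ E]

theorem exists_polynomial_eval_eq_det_one_add_smul (A : E →L[ℝ] E) :
    ∃ p : Polynomial ℝ, p.natDegree ≤ Module.finrank ℝ E ∧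
      ∀ t : ℝ, p.eval t = (1 + t • A).det := by
  classical
  let b := Module.finBasis ℝ E
  let M := LinearMap.toMatrix b b (A : E →ₗ[ℝ] E)
  refine ⟨(-M).charpolyRev, ?_, fun t => ?_⟩
  · rw [← Matrix.reverse_charpoly]
    refine (Polynomial.reverse_natDegree_le _).trans ?_
    rw [Matrix.charpoly_natDegree_eq_dim]
    simp
  · have h1 : (1 + t • A).det = LinearMap.det (1 + t • (A : E →ₗ[ℝ] E)) := rfl
    rw [h1, ← LinearMap.det_toMatrix b, Matrix.charpolyRev, ← Polynomial.coe_evalRingHom,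
      RingHom.map_det]
    congr 1
    ext i j
    simp [M, Matrix.one_apply, LinearMap.toMatrix_one]
    split_ifs <;> simp [mul_comm]

theorem det_one_add_smul_pos {A : E →L[ℝ] E} {t : ℝ} (ht : 0 ≤ t) (h : t * ‖A‖ < 1) :
    0 < (1 + t • A).det := by
  obtain ⟨p, -, hp⟩ := exists_polynomial_eval_eq_det_one_add_smul A
  have hne : ∀ s ∈ Icc 0 t, p.eval s ≠ 0 := by
    intro s hs h0
    rw [hp s] at h0
    obtain ⟨v, hv, hv0⟩ := Submodule.exists_mem_ne_zero_of_ne_bot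
      (LinearMap.bot_lt_ker_of_det_eq_zero (f := ((1 + s • A : E →L[ℝ] E) : E →ₗ[ℝ] E)) h0).ne'
    have h1 : v + s • A v = 0 := by simpa using hv
    have h2 : ‖v‖ ≤ s * (‖A‖ * ‖v‖) := by
      calc ‖v‖ = s * ‖A v‖ := by
            conv_lhs => rw [eq_neg_of_add_eq_zero_left h1]
            rw [norm_neg, norm_smul, Real.norm_of_nonneg hs.1]
        _ ≤ s * (‖A‖ * ‖v‖) := mul_le_mul_of_nonneg_left (A.le_opNorm v) hs.1
    have h3 : 0 < ‖v‖ := norm_pos_iff.2 hv0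
    have h4 : s * ‖A‖ ≤ t * ‖A‖ := by gcongr; exact hs.2
    nlinarith
  rw [← hp]
  by_contra hcon
  have h0 : p.eval 0 = 1 := by
    rw [hp]; simp [ContinuousLinearMap.det]
  obtain ⟨s, hs, hs0⟩ := intermediate_value_Icc' ht p.continuous.continuousOn
    (show (0 : ℝ) ∈ Icc (p.eval t) (p.eval 0) from ⟨not_lt.1 hcon, by rw [h0]; norm_num⟩)
  exact hne s hs hs0

variable [MeasurableSpace E] [BorelSpace E]

/-- For small `t`, the map `(1 - t) x + t r(x)` is a bijection of the open ball onto itself, so the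
integral of its Jacobian is the volume of the ball. -/
theorem setIntegral_det_one_add_smul_eq {r : E → E} (hr : ContDiff ℝ 1 r) {ρ : ℝ} (hρ : 0 < ρ)
    (hball : ∀ x ∈ closedBall (0 : E) ρ, ‖r x‖ ≤ ρ) (hsphere : ∀ x, ‖x‖ = ρ → r x = x) :
    ∃ t₀ > (0 : ℝ), ∀ t, 0 < t → t < t₀ →
      ∫ x in ball (0 : E) ρ, (1 + t • (fderiv ℝ r x - 1)).det = volume.real (ball (0 : E) ρ) := by
  set g : E → E := fun x => r x - x with hg
  have hgc : ContDiff ℝ 1 g := hr.sub contDiff_id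
  have hg' : ∀ x, HasFDerivAt g (fderiv ℝ r x - 1) x := fun x =>
    ((hr.differentiable one_ne_zero x).hasFDerivAt).sub (hasFDerivAt_id x)
  have hcont : Continuous fun x => fderiv ℝ r x - 1 :=
    (hr.continuous_fderiv one_ne_zero).sub continuous_const
  obtain ⟨L, hL⟩ := (isCompact_closedBall (0 : E) ρ).exists_bound_of_continuousOn
    hcont.continuousOn
  have hLip : ∀ x ∈ closedBall (0 : E) ρ, ∀ y ∈ closedBall (0 : E) ρ,
      ‖g y - g x‖ ≤ L * ‖y - x‖ := fun x hx y hy =>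
    (convex_closedBall (0 : E) ρ).norm_image_sub_le_of_norm_hasFDerivWithin_le
      (fun z _ => (hg' z).hasFDerivWithinAt) hL hx hy
  have hL0 : 0 ≤ L := (norm_nonneg _).trans (hL 0 (by simp [hρ.le]))
  -- This bound gives both `t * L < 1`, for injectivity and a positive determinant, and `t < 1`, for
  -- a genuine convex combination.
  refine ⟨1 / (L + 1), by positivity, fun t ht htL => ?_⟩
  have htL' : t * (L + 1) < 1 := (lt_div_iff₀ (by positivity)).1 htL
  have ht1 : t < 1 := by nlinarith
  set φ : E → E := fun x => x + t • g x with hφ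
  have hφ' : ∀ x, HasFDerivAt φ (1 + t • (fderiv ℝ r x - 1)) x := fun x =>
    (hasFDerivAt_id x).add ((hg' x).const_smul t)
  have hφc : ContDiff ℝ 1 φ := contDiff_id.add (hgc.const_smul t)
  have hdet : ∀ x ∈ closedBall (0 : E) ρ, 0 < (1 + t • (fderiv ℝ r x - 1)).det := by
    intro x hx
    refine det_one_add_smul_pos ht.le ?_
    have := hL x hx
    nlinarith
  have hinj : InjOn φ (closedBall (0 : E) ρ) := by
    intro x hx y hy hxy
    by_contra hne
    have h1 : y - x = t • (g x - g y) := by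
      have : x + t • g x = y + t • g y := hxy
      rw [smul_sub, sub_eq_sub_iff_add_eq_add, ← this, add_comm]
    have h2 := hLip y hy x hx
    have h3 : ‖y - x‖ ≤ t * (L * ‖x - y‖) := by
      rw [h1, norm_smul, Real.norm_of_nonneg ht.le]
      gcongr
    rw [norm_sub_rev] at h3
    have h4 : 0 < ‖x - y‖ := norm_pos_iff.2 (sub_ne_zero.2 hne)
    nlinarith
  have hφeq : ∀ x, φ x = (1 - t) • x + t • r x := fun x => by
    simp only [hφ, hg, smul_sub, sub_smul, one_smul]; abel
  have hmap : φ '' ball 0 ρ ⊆ ball 0 ρ := by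
    rintro _ ⟨x, hx, rfl⟩
    rw [mem_ball_zero_iff] at hx ⊢
    rw [hφeq]
    refine (norm_add_le _ _).trans_lt ?_
    rw [norm_smul, norm_smul, Real.norm_of_nonneg ht.le, Real.norm_of_nonneg (by linarith)]
    have := hball x (by simpa using hx.le)
    nlinarith
  have hopen : IsOpen (φ '' ball 0 ρ) := by
    rw [isOpen_iff_mem_nhds]
    rintro _ ⟨x, hx, rfl⟩
    have hs : HasStrictFDerivAt φ (((1 + t • (fderiv ℝ r x - 1)).toContinuousLinearEquivOfDetNeZero
        (hdet x (ball_subset_closedBall hx)).ne' : E ≃L[ℝ] E) : E →L[ℝ] E) x :=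
      hφc.contDiffAt.hasStrictFDerivAt' (hφ' x) one_ne_zero
    rw [← hs.map_nhds_eq_of_equiv]
    exact image_mem_map (isOpen_ball.mem_nhds hx)
  -- The image is open by the inverse function theorem and relatively closed in the ball, because
  -- `φ` fixes the sphere; connectedness concludes.
  have himage : φ '' ball 0 ρ = ball 0 ρ := by
    refine hmap.antisymm ?_
    refine (convex_ball (0 : E) ρ).isPreconnected.subset_of_closure_inter_subset hopen ?_ ?_
    · exact ⟨φ 0, hmap (mem_image_of_mem _ (mem_ball_self hρ)),
        mem_image_of_mem _ (mem_ball_self hρ)⟩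
    · rintro y ⟨hy, hyb⟩
      have hcl : closure (φ '' ball 0 ρ) ⊆ φ '' closedBall 0 ρ :=
        closure_minimal (image_mono ball_subset_closedBall)
          ((isCompact_closedBall (0 : E) ρ).image hφc.continuous).isClosed
      obtain ⟨x, hx, rfl⟩ := hcl hy
      rw [mem_closedBall_zero_iff] at hx
      rcases hx.lt_or_eq with h | h
      · exact mem_image_of_mem _ (by simpa using h)
      · rw [hφeq, hsphere x h, ← add_smul, sub_add_cancel, one_smul, mem_ball_zero_iff] at hyb
        exact absurd h hyb.ne
  have key := integral_image_eq_integral_abs_det_fderiv_smul volume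
    (measurableSet_ball (x := (0 : E)) (ε := ρ)) (fun x _ => (hφ' x).hasFDerivWithinAt)
    (hinj.mono ball_subset_closedBall) (fun _ => (1 : ℝ))
  rw [himage] at key
  simp only [smul_eq_mul, mul_one, integral_const, MeasurableSet.univ, measureReal_restrict_apply,
    univ_inter] at key
  rw [key]
  exact setIntegral_congr_fun measurableSet_ball fun x hx =>
    (abs_of_pos (hdet x (ball_subset_closedBall hx))).symm

/-- The integral of the Jacobian at parameter `t` is a polynomial in `t`, constant near `0+`, hence
constant; `t = 1` gives `r`. Lagrange interpolation at `dim + 1` small nodes makes this explicit. -/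
theorem setIntegral_det_fderiv_eq_of_eq_id_on_sphere {r : E → E} (hr : ContDiff ℝ 1 r) {ρ : ℝ}
    (hρ : 0 < ρ) (hball : ∀ x ∈ closedBall (0 : E) ρ, ‖r x‖ ≤ ρ)
    (hsphere : ∀ x, ‖x‖ = ρ → r x = x) :
    ∫ x in ball (0 : E) ρ, (fderiv ℝ r x).det = volume.real (ball (0 : E) ρ) := by
  obtain ⟨t₀, ht₀, h⟩ := setIntegral_det_one_add_smul_eq hr hρ hball hsphere
  set s : Finset ℕ := Finset.range (Module.finrank ℝ E + 1)
  let v : ℕ → ℝ := fun i => t₀ / (i + 2)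
  have hv : InjOn v s := by
    intro i _ j _ hij
    have h1 : ((i : ℝ) + 2) = j + 2 := by
      simpa [v, div_eq_mul_inv, ht₀.ne'] using hij
    exact_mod_cast add_right_cancel h1
  have hv0 : ∀ i, 0 < v i := fun i => by positivity
  have hv1 : ∀ i, v i < t₀ := fun i => by
    rw [div_lt_iff₀ (by positivity)]
    have : (0 : ℝ) ≤ i := i.cast_nonneg
    nlinarith
  have hinterp : ∀ x, (fderiv ℝ r x).det =
      ∑ i ∈ s, (Lagrange.basis s v i).eval 1 * (1 + v i • (fderiv ℝ r x - 1)).det := by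
    intro x
    obtain ⟨p, hp, hpe⟩ := exists_polynomial_eval_eq_det_one_add_smul (fderiv ℝ r x - 1)
    have hdeg : p.degree < s.card := by
      refine p.degree_le_natDegree.trans_lt ?_
      simp only [s, Finset.card_range]
      exact_mod_cast Nat.lt_succ_of_le hp
    have h1 := congrArg (Polynomial.eval 1) (Lagrange.eq_interpolate hv hdeg)
    rw [hpe, one_smul, add_sub_cancel, Lagrange.interpolate_apply, Polynomial.eval_finsetSum] at h1
    rw [h1]
    exact Finset.sum_congr rfl fun i _ => by simp [hpe, mul_comm]
  have hint : ∀ i, IntegrableOn (fun x => (1 + v i • (fderiv ℝ r x - 1)).det) (ball 0 ρ) := by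
    intro i
    have hd : Continuous (fderiv ℝ r) := hr.continuous_fderiv one_ne_zero
    have hc : Continuous fun x => (1 + v i • (fderiv ℝ r x - 1)).det :=
      ContinuousLinearMap.continuous_det.comp (by fun_prop)
    exact (hc.continuousOn.integrableOn_compact (isCompact_closedBall (0 : E) ρ)).mono_set
      ball_subset_closedBall
  simp_rw [hinterp]
  rw [integral_finsetSum _ fun i _ => (hint i).const_mul _]
  simp_rw [integral_const_mul]
  rw [Finset.sum_congr rfl fun i _ => by rw [h (v i) (hv0 i) (hv1 i)], ← Finset.sum_mul,
    ← Polynomial.eval_finsetSum, Lagrange.sum_basis hv (by simp [s]), Polynomial.eval_one, one_mul]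

/-- Differentiating the constant `‖r‖ ^ 2` shows that the range of `fderiv ℝ r x` is orthogonal to
`r x ≠ 0`. The Jacobian therefore vanishes, while its integral should be the volume of the ball. -/
theorem not_exists_contDiff_retraction_sphere {r : E → E} (hr : ContDiff ℝ 1 r) {ρ : ℝ}
    (hρ : 0 < ρ) (hnorm : ∀ x, ‖r x‖ = ρ) (hsphere : ∀ x, ‖x‖ = ρ → r x = x) : False := by
  have h := setIntegral_det_fderiv_eq_of_eq_id_on_sphere hr hρ (fun x _ => (hnorm x).le) hsphere
  have h0 : ∀ x, (fderiv ℝ r x).det = 0 := by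
    intro x
    by_contra hne
    have hd := (hr.differentiable one_ne_zero x).hasFDerivAt
    have h1 := hd.norm_sq
    have h2 : (fun y => ‖r y‖ ^ 2) = fun _ => ρ ^ 2 := funext fun y => by rw [hnorm]
    rw [h2] at h1
    have h3 := h1.unique (hasFDerivAt_const _ _)
    let e := (fderiv ℝ r x).toContinuousLinearEquivOfDetNeZero hne
    have h4 : fderiv ℝ r x (e.symm (r x)) = r x := e.apply_symm_apply (r x)
    have h5 := DFunLike.congr_fun h3 (e.symm (r x))
    simp [h4] at h5
    have := hnorm x
    rw [h5, norm_zero] at this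
    exact hρ.ne this
  simp only [h0, integral_zero] at h
  have : 0 < volume.real (ball (0 : E) ρ) :=
    ENNReal.toReal_pos (measure_ball_pos _ _ hρ).ne' measure_ball_lt_top.ne
  exact this.ne h

end Brouwer

theorem exists_fixedPoint_of_contDiff_of_bounded {E : Type*} [NormedAddCommGroup E]
    [InnerProductSpace ℝ E] [FiniteDimensional ℝ E] {f : E → E} (hf : ContDiff ℝ 1 f) {C : ℝ}
    (hC : ∀ x, ‖f x‖ ≤ C) : ∃ x, f x = x := by
  borelize E
  by_contra! hne
  have hC0 : 0 ≤ C := (norm_nonneg _).trans (hC 0)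
  -- With this cutoff, `h` is the identity on the sphere of radius `C + 2`, and a zero of `h` has
  -- norm at most `C`, where `χ = 1`, so it would be a fixed point of `f`. Normalizing `h` gives the
  -- forbidden retraction.
  let χ : ContDiffBump (0 : E) := ⟨C + 1, C + 2, by linarith, by linarith⟩
  let h : E → E := fun x => x - χ x • f x
  have hh : ContDiff ℝ 1 h := contDiff_id.sub (χ.contDiff.smul hf)
  have hh0 : ∀ x, h x ≠ 0 := by
    intro x hx
    have hx' : x = χ x • f x := sub_eq_zero.1 hx
    have hle : ‖x‖ ≤ C := by
      rw [hx', norm_smul, Real.norm_of_nonneg χ.nonneg]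
      calc χ x * ‖f x‖ ≤ 1 * C := mul_le_mul χ.le_one (hC x) (norm_nonneg _) zero_le_one
        _ = C := one_mul C
    rw [χ.one_of_mem_closedBall (by simp [χ]; linarith), one_smul] at hx'
    exact hne x hx'.symm
  refine not_exists_contDiff_retraction_sphere (r := fun x => ((C + 2) / ‖h x‖) • h x)
    (ρ := C + 2) ?_ (by linarith) ?_ ?_
  · exact (contDiff_const.div (hh.norm ℝ hh0) fun x => norm_ne_zero_iff.2 (hh0 x)).smul hh
  · intro x
    rw [norm_smul, norm_div, norm_norm, div_mul_cancel₀ _ (norm_ne_zero_iff.2 (hh0 x)),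
      Real.norm_of_nonneg (by linarith)]
  · intro x hx
    have h1 : χ x = 0 := χ.zero_of_le_dist (by simp [χ, hx])
    have h2 : h x = x := by simp [h, h1]
    simp only [h2, hx]
    rw [div_self (by linarith), one_smul]

namespace Calibration

/-! ### Scores, and a forecast making any combination of them small. -/

section Score

variable {Ω : Type*} [Fintype Ω]

theorem prob_nonneg (p : Forecast Ω) (A : Set Ω) : 0 ≤ prob p A :=
  Finset.sum_nonneg fun _ _ => Set.indicator_nonneg (fun y _ => p.2.1 y) _

theorem prob_mono (p : Forecast Ω) {A B : Set Ω} (h : A ⊆ B) : prob p A ≤ prob p B :=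
  Finset.sum_le_sum fun x _ => Set.indicator_le_indicator_of_subset h (fun y => p.2.1 y) x

theorem prob_pos {p : Forecast Ω} (hp : ∀ x, 0 < p.1 x) {A : Set Ω} {x : Ω} (hx : x ∈ A) :
    0 < prob p A := by
  refine Finset.sum_pos' (fun _ _ => Set.indicator_nonneg (fun y _ => p.2.1 y) _)
    ⟨x, Finset.mem_univ x, ?_⟩
  rw [Set.indicator_of_mem hx]
  exact hp x

/-- The difference between the outcome and the forecast of the event `T` conditional on `U`, if
the outcome `x` is in `U`, and `0` otherwise. -/
noncomputable def score (p : Forecast Ω) (U T : Set Ω) : Ω → ℝ :=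
  U.indicator fun x => T.indicator 1 x - prob p (T ∩ U) / prob p U

theorem abs_score_le_one (p : Forecast Ω) (U T : Set Ω) (x : Ω) : |score p U T x| ≤ 1 := by
  unfold score
  by_cases hU : x ∈ U
  · rw [Set.indicator_of_mem hU]
    have h0 : 0 ≤ prob p (T ∩ U) / prob p U := div_nonneg (prob_nonneg _ _) (prob_nonneg _ _)
    have h1 : prob p (T ∩ U) / prob p U ≤ 1 :=
      div_le_one_of_le₀ (prob_mono p Set.inter_subset_right) (prob_nonneg _ _)
    by_cases hT : x ∈ T
    · simp only [Set.indicator_of_mem hT, Pi.one_apply]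
      rw [abs_le]; constructor <;> linarith
    · rw [Set.indicator_of_notMem hT, abs_le]; constructor <;> linarith
  · simp [Set.indicator_of_notMem hU]

/-- An outcome drawn from `p` has conditional frequency `p(T | U)` in `U`. If `p(U) = 0`, every term
has weight zero. -/
theorem sum_mul_score (p : Forecast Ω) (U T : Set Ω) : ∑ x, p.1 x * score p U T x = 0 := by
  have h : ∀ x, p.1 x * score p U T x = (T ∩ U).indicator (fun y => p.1 y) x -
      U.indicator (fun y => p.1 y) x * (prob p (T ∩ U) / prob p U) := by
    intro x
    by_cases hU : x ∈ U <;> by_cases hT : x ∈ T <;> simp [score, hU, hT, mul_sub]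
  simp_rw [h]
  rw [Finset.sum_sub_distrib, ← Finset.sum_mul]
  change prob p (T ∩ U) - prob p U * (prob p (T ∩ U) / prob p U) = 0
  by_cases h0 : prob p U = 0
  · have := prob_mono p (Set.inter_subset_right : T ∩ U ⊆ U)
    rw [h0] at this
    rw [h0, zero_mul, sub_zero]
    exact this.antisymm (prob_nonneg _ _)
  · rw [mul_div_cancel₀ _ h0, sub_self]

variable [Nonempty Ω]

/-- The forecast with weights proportional to the exponentials of the given numbers. -/
noncomputable def softmax (y : Ω → ℝ) : Forecast Ω :=
  ⟨fun x => Real.exp (y x) / ∑ z, Real.exp (y z),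
    fun _ => div_nonneg (Real.exp_pos _).le (Finset.sum_nonneg fun _ _ => (Real.exp_pos _).le), by
      rw [← Finset.sum_div, div_self]
      exact (Finset.sum_pos (fun _ _ => Real.exp_pos _) Finset.univ_nonempty).ne'⟩

theorem softmax_apply (y : Ω → ℝ) (x : Ω) :
    (softmax y).1 x = Real.exp (y x) / ∑ z, Real.exp (y z) := rfl

theorem softmax_pos (y : Ω → ℝ) (x : Ω) : 0 < (softmax y).1 x :=
  div_pos (Real.exp_pos _) (Finset.sum_pos (fun _ _ => Real.exp_pos _) Finset.univ_nonempty)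

theorem contDiff_prob_softmax (A : Set Ω) :
    ContDiff ℝ 1 fun y : EuclideanSpace ℝ Ω => prob (softmax y) A := by
  unfold prob
  refine ContDiff.sum fun x _ => ?_
  by_cases hx : x ∈ A
  · simp only [Set.indicator_of_mem hx, softmax_apply]
    refine ContDiff.div (by fun_prop) (by fun_prop) fun y => ?_
    exact (Finset.sum_pos (fun _ _ => Real.exp_pos _) Finset.univ_nonempty).ne'
  · simp only [Set.indicator_of_notMem hx]
    exact contDiff_const

theorem contDiff_score_softmax (U T : Set Ω) (x : Ω) :
    ContDiff ℝ 1 fun y : EuclideanSpace ℝ Ω => score (softmax y) U T x := by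
  unfold score
  by_cases hx : x ∈ U
  · simp only [Set.indicator_of_mem hx]
    exact contDiff_const.sub ((contDiff_prob_softmax _).div (contDiff_prob_softmax _)
      fun y => (prob_pos (softmax_pos y) hx).ne')
  · simp only [Set.indicator_of_notMem hx]
    exact contDiff_const

/-- Conditional probabilities are discontinuous at the boundary of the simplex; the softmax
parametrization stays in its interior and is smooth on a whole Euclidean space. The tolerance `δ` is
the price of never reaching the boundary. -/
theorem exists_forecast_sum_score_le (c : Set Ω → Set Ω → ℝ) {δ : ℝ} (hδ : 0 < δ) :
    ∃ p : Forecast Ω, (∀ x, 0 < p.1 x) ∧ ∀ x, ∑ U, ∑ T, c U T * score p U T x ≤ δ := by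
  let V : Forecast Ω → Ω → ℝ := fun p x => ∑ U, ∑ T, c U T * score p U T x
  have hVC : ∀ p x, |V p x| ≤ ∑ U, ∑ T, |c U T| := fun p x => by
    refine (Finset.abs_sum_le_sum_abs _ _).trans (Finset.sum_le_sum fun U _ => ?_)
    refine (Finset.abs_sum_le_sum_abs _ _).trans (Finset.sum_le_sum fun T _ => ?_)
    rw [abs_mul]
    exact mul_le_of_le_one_right (abs_nonneg _) (abs_score_le_one _ _ _ _)
  have hV0 : ∀ p : Forecast Ω, ∑ x, p.1 x * V p x = 0 := fun p => by
    simp only [V, Finset.mul_sum]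
    rw [Finset.sum_comm]
    refine Finset.sum_eq_zero fun U _ => ?_
    rw [Finset.sum_comm]
    refine Finset.sum_eq_zero fun T _ => ?_
    simp_rw [mul_left_comm]
    rw [← Finset.mul_sum, sum_mul_score, mul_zero]
  have hk : (0 : ℝ) < Fintype.card Ω := by exact_mod_cast Fintype.card_pos
  set η : ℝ := δ / Fintype.card Ω with hη
  have hη0 : 0 < η := div_pos hδ hk
  let f : EuclideanSpace ℝ Ω → EuclideanSpace ℝ Ω := fun y =>
    WithLp.toLp 2 fun x => V (softmax y) x / η
  have hf : ContDiff ℝ 1 f := by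
    rw [contDiff_euclidean]
    intro x
    exact (ContDiff.sum fun U _ => ContDiff.sum fun T _ =>
      contDiff_const.mul (contDiff_score_softmax U T x)).div_const η
  have hfC : ∀ y, ‖f y‖ ≤ √(∑ _x : Ω, ((∑ U, ∑ T, |c U T|) / η) ^ 2) := by
    intro y
    rw [EuclideanSpace.norm_eq]
    refine Real.sqrt_le_sqrt (Finset.sum_le_sum fun x _ => ?_)
    refine pow_le_pow_left₀ (norm_nonneg _) ?_ 2
    simp only [f, Real.norm_eq_abs, abs_div, abs_of_pos hη0]
    exact div_le_div_of_nonneg_right (hVC _ x) hη0.le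
  -- At the fixed point the combined score is `η * y`. Its mean under `softmax y` is zero, which
  -- reads `∑ exp(y x) * y x = 0`.
  obtain ⟨y, hy⟩ := exists_fixedPoint_of_contDiff_of_bounded hf hfC
  have hVy : ∀ x, V (softmax y) x = η * y x := fun x => by
    have h1 : V (softmax y) x / η = y x := congrArg (fun z : EuclideanSpace ℝ Ω => z x) hy
    rw [← h1, mul_div_cancel₀ _ hη0.ne']
  have hsum : ∑ x, Real.exp (y x) * y x = 0 := by
    have h1 := hV0 (softmax y)
    have hZ : (0 : ℝ) < ∑ z, Real.exp (y z) :=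
      Finset.sum_pos (fun _ _ => Real.exp_pos _) Finset.univ_nonempty
    have h2 : ∀ x, (softmax y).1 x * V (softmax y) x =
        (η / ∑ z, Real.exp (y z)) * (Real.exp (y x) * y x) := fun x => by
      rw [hVy, softmax_apply]; ring
    simp_rw [h2] at h1
    rw [← Finset.mul_sum] at h1
    exact (mul_eq_zero.1 h1).resolve_left (div_pos hη0 hZ).ne'
  refine ⟨softmax y, softmax_pos y, fun x => ?_⟩
  change V (softmax y) x ≤ δ
  -- Since `s * exp s ≥ -1`, a positive term of this zero sum is at most `card Ω`, and it is at
  -- least `y x`.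
  have hle : y x ≤ Fintype.card Ω := by
    classical
    by_cases h0 : y x ≤ 0
    · exact h0.trans hk.le
    · push Not at h0
      rw [← Finset.add_sum_erase _ _ (Finset.mem_univ x)] at hsum
      have h1 : -((Finset.univ.erase x).card : ℝ) ≤
          ∑ z ∈ Finset.univ.erase x, Real.exp (y z) * y z := by
        rw [← mul_neg_one, ← nsmul_eq_mul]
        refine Finset.card_nsmul_le_sum _ _ _ fun z _ => ?_
        have h2 := Real.add_one_le_exp (-y z)
        have h3 : Real.exp (y z) * Real.exp (-y z) = 1 := by rw [← Real.exp_add]; simp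
        have h4 := mul_le_mul_of_nonneg_left (show -y z ≤ Real.exp (-y z) by linarith)
          (Real.exp_pos (y z)).le
        linarith
      have h5 : ((Finset.univ.erase x).card : ℝ) ≤ Fintype.card Ω := by
        exact_mod_cast Finset.card_le_univ _
      have h6 : y x ≤ Real.exp (y x) * y x :=
        le_mul_of_one_le_left h0.le (Real.one_le_exp h0.le)
      linarith
  rw [hVy]
  calc η * y x ≤ η * Fintype.card Ω := mul_le_mul_of_nonneg_left hle hη0.le
    _ = δ := div_mul_cancel₀ _ hk.ne'

end Score

/-! ### The potential of a rule along a history. -/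

section Potential

variable {Ω : Type*} [Fintype Ω]

/-- The number of active stages along a finite history. -/
noncomputable def activeCount (R : CheckingRule Ω) (h : History Ω) : ℕ :=
  h.reverseRecOn 0 fun l a n => n + (R.active l).indicator 1 a.2

/-- The total score of the forecasts along a finite history. -/
noncomputable def totalScore (R : CheckingRule Ω) (h : History Ω) : ℝ :=
  h.reverseRecOn 0 fun l a s => s + score a.1 (R.active l) (R.tested l) a.2

@[simp] theorem activeCount_nil (R : CheckingRule Ω) : activeCount R [] = 0 := by
  simp [activeCount]

@[simp] theorem activeCount_concat (R : CheckingRule Ω) (h : History Ω) (a : Forecast Ω × Ω) :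
    activeCount R (h ++ [a]) = activeCount R h + (R.active h).indicator 1 a.2 := by
  simp [activeCount]

@[simp] theorem totalScore_nil (R : CheckingRule Ω) : totalScore R [] = 0 := by
  simp [totalScore]

@[simp] theorem totalScore_concat (R : CheckingRule Ω) (h : History Ω) (a : Forecast Ω × Ω) :
    totalScore R (h ++ [a]) = totalScore R h + score a.1 (R.active h) (R.tested h) a.2 := by
  simp [totalScore]

theorem abs_totalScore_le (R : CheckingRule Ω) (h : History Ω) :
    |totalScore R h| ≤ activeCount R h := by
  induction h using List.reverseRecOn with
  | nil => simp
  | append_singleton l a ih =>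
    rw [totalScore_concat, activeCount_concat]
    refine (abs_add_le _ _).trans ?_
    by_cases ha : a.2 ∈ R.active l
    · simp only [Set.indicator_of_mem ha, Pi.one_apply]
      push_cast
      exact add_le_add ih (abs_score_le_one _ _ _ _)
    · simpa [score, ha] using ih

/-- The average score over the active stages. -/
noncomputable def averageScore (R : CheckingRule Ω) (h : History Ω) : ℝ :=
  totalScore R h / activeCount R h

theorem abs_averageScore_le_one (R : CheckingRule Ω) (h : History Ω) : |averageScore R h| ≤ 1 := by
  rw [averageScore, abs_div, Nat.abs_cast]
  exact div_le_one_of_le₀ (abs_totalScore_le R h) (Nat.cast_nonneg _)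

/-- The weight of the next score in the increment of the potential. -/
noncomputable def weight (R : CheckingRule Ω) (h : History Ω) : ℝ :=
  totalScore R h / (activeCount R h + 1) ^ 2

theorem abs_weight_le_one (R : CheckingRule Ω) (h : History Ω) : |weight R h| ≤ 1 := by
  rw [weight, abs_div, abs_of_nonneg (by positivity : (0 : ℝ) ≤ ((activeCount R h : ℝ) + 1) ^ 2)]
  refine div_le_one_of_le₀ ((abs_totalScore_le R h).trans ?_) (by positivity)
  have : (0 : ℝ) ≤ activeCount R h := Nat.cast_nonneg _
  nlinarith

/-- The potential of a checking rule after a finite history. -/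
noncomputable def potential (R : CheckingRule Ω) (h : History Ω) : ℝ :=
  averageScore R h ^ 2 + 2 / (activeCount R h + 1)

theorem potential_nonneg (R : CheckingRule Ω) (h : History Ω) : 0 ≤ potential R h := by
  unfold potential; positivity

theorem potential_le (R : CheckingRule Ω) (h : History Ω) : potential R h ≤ 3 := by
  have h1 : averageScore R h ^ 2 ≤ 1 := (sq_le_one_iff_abs_le_one _).2 (abs_averageScore_le_one R h)
  have h2 : (2 : ℝ) / (activeCount R h + 1) ≤ 2 :=
    div_le_self zero_le_two (by have : (0 : ℝ) ≤ activeCount R h := Nat.cast_nonneg _; linarith)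
  unfold potential
  linarith

/-- The decrease of the potential when the next outcome is `x`, up to the weighted score. -/
noncomputable def decrease (R : CheckingRule Ω) (h : History Ω) (x : Ω) : ℝ :=
  (R.active h).indicator 1 x * (averageScore R h ^ 2 / (activeCount R h + 1))

theorem decrease_nonneg (R : CheckingRule Ω) (h : History Ω) (x : Ω) : 0 ≤ decrease R h x :=
  mul_nonneg (Set.indicator_nonneg (fun _ _ => zero_le_one) _) (by positivity)

theorem decrease_le_one (R : CheckingRule Ω) (h : History Ω) (x : Ω) : decrease R h x ≤ 1 := by
  have h1 : averageScore R h ^ 2 ≤ 1 := (sq_le_one_iff_abs_le_one _).2 (abs_averageScore_le_one R h)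
  have h2 : averageScore R h ^ 2 / (activeCount R h + 1) ≤ 1 := by
    refine div_le_one_of_le₀ ?_ (by positivity)
    have : (0 : ℝ) ≤ activeCount R h := Nat.cast_nonneg _
    linarith
  refine mul_le_one₀ (Set.indicator_le_self' (fun _ _ => zero_le_one) _) (by positivity) h2

/-- The drop of `2 / (N + 1)` pays for the quadratic error `g ^ 2 / (N + 1) ^ 2`, and shrinking the
old average by `N / (N + 1)` releases `(S / N) ^ 2 / (N + 1)`. For `N = 0` the convention `S / 0 =
0` is consistent. -/
theorem sq_average_step {N S g : ℝ} (hN : 0 ≤ N) (hS : N = 0 → S = 0) (hg : |g| ≤ 1) :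
    (((S + g) / (N + 1)) ^ 2 + 2 / (N + 1 + 1)) + (S / N) ^ 2 / (N + 1) ≤
      ((S / N) ^ 2 + 2 / (N + 1)) + 2 * (S / (N + 1) ^ 2 * g) := by
  have hg2 : g ^ 2 ≤ 1 := (sq_le_one_iff_abs_le_one _).2 hg
  rcases hN.eq_or_lt with h0 | h0
  · have := hS h0.symm
    subst this
    rw [← h0]
    norm_num
    linarith
  · have h1 : 1 / (N + 1) ^ 2 ≤ 2 / (N + 1) - 2 / (N + 1 + 1) := by
      rw [div_sub_div _ _ (by positivity) (by positivity), div_le_div_iff₀ (by positivity)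
        (by positivity)]
      nlinarith [mul_pos h0 h0, mul_pos h0 (mul_pos h0 h0)]
    have h2 : ((S + g) / (N + 1)) ^ 2 =
        (S / N) ^ 2 * (N ^ 2 / (N + 1) ^ 2) + 2 * (S / (N + 1) ^ 2 * g) + g ^ 2 / (N + 1) ^ 2 := by
      field_simp
      ring
    have h3 : g ^ 2 / (N + 1) ^ 2 ≤ 1 / (N + 1) ^ 2 := by gcongr
    have h4 : N ^ 2 / (N + 1) ^ 2 + 1 / (N + 1) ≤ 1 := by
      rw [div_add_div _ _ (by positivity) (by positivity), div_le_one (by positivity)]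
      nlinarith [mul_pos h0 h0, mul_pos h0 (mul_pos h0 h0)]
    have h5 := mul_le_mul_of_nonneg_left h4 (sq_nonneg (S / N))
    have h6 : (S / N) ^ 2 / (N + 1) = (S / N) ^ 2 * (1 / (N + 1)) := by ring
    rw [h2, h6]
    linarith

theorem potential_concat_add_decrease_le (R : CheckingRule Ω) (h : History Ω) (p : Forecast Ω)
    (x : Ω) :
    potential R (h ++ [(p, x)]) + decrease R h x ≤
      potential R h + 2 * (weight R h * score p (R.active h) (R.tested h) x) := by
  by_cases hx : x ∈ R.active h
  · simp only [potential, decrease, averageScore, activeCount_concat, totalScore_concat, weight,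
      Set.indicator_of_mem hx, Pi.one_apply, one_mul, Nat.cast_add, Nat.cast_one]
    refine sq_average_step (Nat.cast_nonneg _) (fun h0 => ?_) (abs_score_le_one _ _ _ _)
    have := abs_totalScore_le R h
    rw [h0] at this
    exact abs_nonpos_iff.1 this
  · simp [potential, decrease, averageScore, score, Set.indicator_of_notMem hx]

theorem history_congr (σ : Forecaster Ω) {x y : ℕ → Ω} {n : ℕ} (h : ∀ k < n, x k = y k) :
    history σ x n = history σ y n := by
  induction n with
  | zero => rfl
  | succ n ih =>
    simp only [history]
    rw [ih fun k hk => h k (hk.trans n.lt_succ_self), h n n.lt_succ_self]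

/-! ### Measurability in the rule, and averaging over `μ`. -/

section Measurability

variable [m : MeasurableSpace (CheckingRule Ω)]

theorem measurable_active (hm : cylinderSigmaAlgebra Ω ≤ m) (h : History Ω) :
    Measurable fun R : CheckingRule Ω => R.active h :=
  measurable_set_iff.2 fun x => measurableSet_setOfPred.1 <|
    hm _ (MeasurableSpace.measurableSet_generateFrom ⟨h, x, Or.inl rfl⟩)

theorem measurable_tested (hm : cylinderSigmaAlgebra Ω ≤ m) (h : History Ω) :
    Measurable fun R : CheckingRule Ω => R.tested h :=
  measurable_set_iff.2 fun x => measurableSet_setOfPred.1 <|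
    hm _ (MeasurableSpace.measurableSet_generateFrom ⟨h, x, Or.inr rfl⟩)

theorem measurable_comp_active_tested (hm : cylinderSigmaAlgebra Ω ≤ m) {α : Type*}
    [MeasurableSpace α] (f : Set Ω → Set Ω → α) (h : History Ω) :
    Measurable fun R : CheckingRule Ω => f (R.active h) (R.tested h) :=
  (measurable_of_countable (Function.uncurry f)).comp
    ((measurable_active hm h).prodMk (measurable_tested hm h))

theorem measurable_activeCount (hm : cylinderSigmaAlgebra Ω ≤ m) (h : History Ω) :
    Measurable fun R => activeCount R h := by
  induction h using List.reverseRecOn with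
  | nil => simp
  | append_singleton l a ih =>
    simp only [activeCount_concat]
    exact ih.add (measurable_comp_active_tested hm (fun U _ => U.indicator 1 a.2) l)

theorem measurable_totalScore (hm : cylinderSigmaAlgebra Ω ≤ m) (h : History Ω) :
    Measurable fun R => totalScore R h := by
  induction h using List.reverseRecOn with
  | nil => simp
  | append_singleton l a ih =>
    simp only [totalScore_concat]
    exact ih.add (measurable_comp_active_tested hm (fun U T => score a.1 U T a.2) l)

theorem measurable_activeCount_cast (hm : cylinderSigmaAlgebra Ω ≤ m) (h : History Ω) :
    Measurable fun R => (activeCount R h : ℝ) :=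
  measurable_from_top.comp (measurable_activeCount hm h)

theorem measurable_averageScore (hm : cylinderSigmaAlgebra Ω ≤ m) (h : History Ω) :
    Measurable fun R => averageScore R h :=
  (measurable_totalScore hm h).div (measurable_activeCount_cast hm h)

theorem measurable_weight (hm : cylinderSigmaAlgebra Ω ≤ m) (h : History Ω) :
    Measurable fun R => weight R h :=
  (measurable_totalScore hm h).div (((measurable_activeCount_cast hm h).add_const 1).pow_const 2)

theorem measurable_potential (hm : cylinderSigmaAlgebra Ω ≤ m) (h : History Ω) :
    Measurable fun R => potential R h :=
  ((measurable_averageScore hm h).pow_const 2).add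
    (((measurable_activeCount_cast hm h).add_const 1).const_div 2)

theorem measurable_decrease (hm : cylinderSigmaAlgebra Ω ≤ m) (h : History Ω) (x : Ω) :
    Measurable fun R => decrease R h x :=
  (measurable_comp_active_tested hm (fun U _ => U.indicator (1 : Ω → ℝ) x) h).mul
    (((measurable_averageScore hm h).pow_const 2).div
      ((measurable_activeCount_cast hm h).add_const 1))

variable (μ : Measure (CheckingRule Ω)) [IsProbabilityMeasure μ]

theorem integrable_weight_mul_score (hm : cylinderSigmaAlgebra Ω ≤ m) (h : History Ω)
    (p : Forecast Ω) (x : Ω) :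
    Integrable (fun R => weight R h * score p (R.active h) (R.tested h) x) μ := by
  refine Integrable.of_bound ((measurable_weight hm h).mul
    (measurable_comp_active_tested hm (fun U T => score p U T x) h)).aestronglyMeasurable 1
    (ae_of_all _ fun R => ?_)
  rw [Real.norm_eq_abs, abs_mul]
  exact mul_le_one₀ (abs_weight_le_one _ _) (abs_nonneg _) (abs_score_le_one _ _ _ _)

theorem integrable_potential (hm : cylinderSigmaAlgebra Ω ≤ m) (h : History Ω) :
    Integrable (fun R => potential R h) μ := by
  refine Integrable.of_bound (measurable_potential hm h).aestronglyMeasurable 3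
    (ae_of_all _ fun R => ?_)
  rw [Real.norm_of_nonneg (potential_nonneg R h)]
  exact potential_le R h

theorem integrable_decrease (hm : cylinderSigmaAlgebra Ω ≤ m) (h : History Ω) (x : Ω) :
    Integrable (fun R => decrease R h x) μ := by
  refine Integrable.of_bound (measurable_decrease hm h x).aestronglyMeasurable 1
    (ae_of_all _ fun R => ?_)
  rw [Real.norm_of_nonneg (decrease_nonneg R h x)]
  exact decrease_le_one R h x

/-- The score depends on the rule only through the finitely many pairs `(U, T)`; grouping by them
leaves a finite combination with coefficients independent of `p`. -/
theorem integral_weight_mul_score (hm : cylinderSigmaAlgebra Ω ≤ m) (h : History Ω)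
    (p : Forecast Ω) (x : Ω) :
    ∫ R, weight R h * score p (R.active h) (R.tested h) x ∂μ =
      ∑ U, ∑ T, (∫ R in {R | R.active h = U ∧ R.tested h = T}, weight R h ∂μ) *
        score p U T x := by
  classical
  have hset : ∀ U T, MeasurableSet {R : CheckingRule Ω | R.active h = U ∧ R.tested h = T} :=
    fun U T => (measurable_active hm h (measurableSet_singleton U)).inter
      (measurable_tested hm h (measurableSet_singleton T))
  have hw : Integrable (fun R => weight R h) μ :=
    Integrable.of_bound (measurable_weight hm h).aestronglyMeasurable 1
      (ae_of_all _ fun R => abs_weight_le_one R h)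
  have hpt : ∀ R : CheckingRule Ω, weight R h * score p (R.active h) (R.tested h) x =
      ∑ U, ∑ T, {R : CheckingRule Ω | R.active h = U ∧ R.tested h = T}.indicator
        (fun R => weight R h) R * score p U T x := by
    intro R
    rw [Finset.sum_eq_single (R.active h), Finset.sum_eq_single (R.tested h)]
    · simp
    · intro T _ hT
      simp [hT.symm]
    · simp
    · intro U _ hU
      simp [hU.symm]
    · simp
  simp_rw [hpt]
  rw [integral_finsetSum _ fun U _ => integrable_finsetSum _ fun T _ =>
    (hw.indicator (hset U T)).mul_const _]
  refine Finset.sum_congr rfl fun U _ => ?_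
  rw [integral_finsetSum _ fun T _ => (hw.indicator (hset U T)).mul_const _]
  refine Finset.sum_congr rfl fun T _ => ?_
  rw [integral_mul_const, integral_indicator (hset U T)]

theorem exists_forecaster_integral_weight_mul_score_le [Nonempty Ω]
    (hm : cylinderSigmaAlgebra Ω ≤ m) :
    ∃ σ : Forecaster Ω, (∀ h x, 0 < (σ h).1 x) ∧ ∀ h x,
      ∫ R, weight R h * score (σ h) (R.active h) (R.tested h) x ∂μ ≤ (1 / 2) ^ h.length := by
  have hex : ∀ h : History Ω, ∃ p : Forecast Ω, (∀ x, 0 < p.1 x) ∧ ∀ x,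
      ∫ R, weight R h * score p (R.active h) (R.tested h) x ∂μ ≤ (1 / 2) ^ h.length := by
    intro h
    simp_rw [integral_weight_mul_score μ hm]
    exact exists_forecast_sum_score_le _ (by positivity)
  choose σ hσ using hex
  exact ⟨σ, fun h => (hσ h).1, fun h => (hσ h).2⟩

theorem tsum_lintegral_decrease_le (hm : cylinderSigmaAlgebra Ω ≤ m) {σ : Forecaster Ω}
    (hσ : ∀ h x,
      ∫ R, weight R h * score (σ h) (R.active h) (R.tested h) x ∂μ ≤ (1 / 2) ^ h.length)
    (x : ℕ → Ω) :
    ∑' n, ∫⁻ R, ENNReal.ofReal (decrease R (history σ x n) (x n)) ∂μ ≤ ENNReal.ofReal 7 := by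
  have hlen : ∀ n, (history σ x n).length = n := fun n => by
    induction n with
    | zero => rfl
    | succ n ih => simp [history, ih]
  have hstep : ∀ n, ∫ R, decrease R (history σ x n) (x n) ∂μ ≤
      ∫ R, potential R (history σ x n) ∂μ - ∫ R, potential R (history σ x (n + 1)) ∂μ +
        2 * (1 / 2) ^ n := by
    intro n
    have h1 := integral_mono ((integrable_potential μ hm (history σ x (n + 1))).add
      (integrable_decrease μ hm (history σ x n) (x n)))
      ((integrable_potential μ hm (history σ x n)).add
        ((integrable_weight_mul_score μ hm (history σ x n) (σ (history σ x n)) (x n)).const_mul 2))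
      fun R => potential_concat_add_decrease_le R (history σ x n) (σ (history σ x n)) (x n)
    rw [integral_add' (integrable_potential μ hm _) (integrable_decrease μ hm _ _),
      integral_add' (integrable_potential μ hm _)
        ((integrable_weight_mul_score μ hm _ _ _).const_mul 2), integral_const_mul] at h1
    have h2 := hσ (history σ x n) (x n)
    rw [hlen] at h2
    linarith
  -- Here `7 = 3 + 2 * 2`: the initial potential plus twice the geometric series.
  have hpartial : ∀ k, ∑ n ∈ Finset.range k, ∫ R, decrease R (history σ x n) (x n) ∂μ ≤ 7 := by
    intro k
    have h1 := Finset.sum_le_sum fun n (_ : n ∈ Finset.range k) => hstep n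
    rw [Finset.sum_add_distrib, Finset.sum_range_sub', ← Finset.mul_sum] at h1
    have h2 : ∑ n ∈ Finset.range k, (1 / 2 : ℝ) ^ n ≤ 2 := sum_geometric_two_le k
    have h3 : ∫ R, potential R (history σ x 0) ∂μ ≤ 3 := by
      refine (integral_mono (integrable_potential μ hm _) (integrable_const 3)
        fun R => potential_le R _).trans ?_
      simp
    have h4 : 0 ≤ ∫ R, potential R (history σ x k) ∂μ :=
      integral_nonneg fun R => potential_nonneg R _
    linarith
  refine ENNReal.tsum_le_of_sum_range_le fun k => ?_
  simp_rw [← ofReal_integral_eq_lintegral_ofReal (integrable_decrease μ hm _ _)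
    (ae_of_all _ fun R => decrease_nonneg R _ _)]
  rw [← ENNReal.ofReal_sum_of_nonneg fun n _ => integral_nonneg fun R => decrease_nonneg R _ _]
  exact ENNReal.ofReal_le_ofReal (hpartial k)

theorem measurable_decrease_history [MeasurableSpace Ω] [MeasurableSingletonClass Ω]
    (hm : cylinderSigmaAlgebra Ω ≤ m) (σ : Forecaster Ω) (n : ℕ) :
    Measurable fun z : CheckingRule Ω × (ℕ → Ω) =>
      decrease z.1 (history σ z.2 n) (z.2 n) := by
  -- Only the first `n + 1` outcomes matter, so the play ranges over a finite set and measurability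
  -- in the rule for each word is enough.
  let e : (Fin (n + 1) → Ω) → ℕ → Ω := fun w k => w ⟨min k n, by omega⟩
  have h1 : Measurable fun z : CheckingRule Ω × (Fin (n + 1) → Ω) =>
      decrease z.1 (history σ (e z.2) n) (e z.2 n) :=
    measurable_from_prod_countable_left fun w =>
      measurable_decrease hm (history σ (e w) n) (e w n)
  have h2 : Measurable fun z : CheckingRule Ω × (ℕ → Ω) => (z.1, fun i : Fin (n + 1) => z.2 i) := by
    fun_prop
  convert h1.comp h2 using 1
  funext z
  have h3 : history σ z.2 n = history σ (e fun i => z.2 i) n :=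
    history_congr σ fun k hk => by simp [e, hk.le]
  simp [h3, e]

/-- The bound holds for each outcome sequence, so it may be integrated against any `ν`. The
exceptional rules appear only after the exchange of integrals, hence depend on `ν`. -/
theorem ae_ae_summable_decrease [MeasurableSpace Ω] [MeasurableSingletonClass Ω]
    (hm : cylinderSigmaAlgebra Ω ≤ m) {σ : Forecaster Ω}
    (hσ : ∀ h x,
      ∫ R, weight R h * score (σ h) (R.active h) (R.tested h) x ∂μ ≤ (1 / 2) ^ h.length)
    (ν : Measure (ℕ → Ω)) [IsProbabilityMeasure ν] :
    ∀ᵐ R ∂μ, ∀ᵐ x ∂ν, Summable fun n => decrease R (history σ x n) (x n) := by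
  let F : CheckingRule Ω → (ℕ → Ω) → ℝ≥0∞ := fun R x =>
    ∑' n, ENNReal.ofReal (decrease R (history σ x n) (x n))
  have hF : Measurable (Function.uncurry F) :=
    Measurable.tsum fun n => (measurable_decrease_history hm σ n).ennreal_ofReal
  have hle : ∫⁻ R, ∫⁻ x, F R x ∂ν ∂μ ≤ ENNReal.ofReal 7 := by
    rw [lintegral_lintegral_swap hF.aemeasurable]
    calc ∫⁻ x, ∫⁻ R, F R x ∂μ ∂ν ≤ ∫⁻ _, ENNReal.ofReal 7 ∂ν := by
          refine lintegral_mono fun x => ?_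
          simp only [F]
          rw [lintegral_tsum fun n => (measurable_decrease hm _ _).ennreal_ofReal.aemeasurable]
          exact tsum_lintegral_decrease_le μ hm hσ x
      _ = ENNReal.ofReal 7 := by simp
  filter_upwards [ae_lt_top hF.lintegral_prod_right
    (hle.trans_lt ENNReal.ofReal_lt_top).ne] with R hR
  filter_upwards [ae_lt_top (hF.comp measurable_prodMk_left) hR.ne] with x hx
  simpa only [ENNReal.toReal_ofReal (decrease_nonneg _ _ _)] using ENNReal.summable_toReal hx.ne

end Measurability

end Potential

end Calibration

/-! ### Convergence of averages from a weighted sum of squares. -/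

open scoped Topology

/-- With `u = 1 / (N + 1)`, increments of averages are only `O(u)`, which is not summable when `N →
∞`; cubing gains the factor `a ^ 2` and leaves two summable terms. -/
theorem abs_cube_sub_cube_le {a b u : ℝ} (h : |b - a| ≤ 2 * u) (hu0 : 0 ≤ u) (hu1 : u ≤ 1) :
    |b ^ 3 - a ^ 3| ≤ 9 * (a ^ 2 * u) + 24 * u ^ 2 := by
  have h1 : b ^ 3 - a ^ 3 = (b - a) * (b ^ 2 + b * a + a ^ 2) := by ring
  have h2 : |b ^ 2 + b * a + a ^ 2| ≤ 9 / 2 * a ^ 2 + 3 * (b - a) ^ 2 := by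
    rw [abs_le]
    constructor <;> nlinarith [sq_nonneg (b + a), sq_nonneg (b - a), sq_nonneg (b - 2 * a)]
  have h3 : (b - a) ^ 2 ≤ 4 * u ^ 2 := by
    rw [← sq_abs]; nlinarith [abs_nonneg (b - a)]
  rw [h1, abs_mul]
  calc |b - a| * |b ^ 2 + b * a + a ^ 2| ≤ (2 * u) * (9 / 2 * a ^ 2 + 3 * (4 * u ^ 2)) := by
        gcongr
        linarith
    _ = 9 * (a ^ 2 * u) + 24 * (u ^ 2 * u) := by ring
    _ ≤ 9 * (a ^ 2 * u) + 24 * (u ^ 2 * 1) := by gcongr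
    _ = 9 * (a ^ 2 * u) + 24 * u ^ 2 := by ring

/-- An average over a growing number `N n` of terms bounded by `1` tends to zero as soon as its
squares, weighted by `1 / (N n + 1)` at the times when `N` increases, are summable. -/
theorem tendsto_average_of_summable_sq {N : ℕ → ℕ} {S : ℕ → ℝ} {e : ℕ → ℕ}
    (he : ∀ n, e n ≤ 1) (hN : ∀ n, N (n + 1) = N n + e n)
    (hS : ∀ n, |S (n + 1) - S n| ≤ e n) (hSN : ∀ n, |S n| ≤ N n)
    (hsum : Summable fun n => (e n : ℝ) * ((S n / N n) ^ 2 / (N n + 1)))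
    (htop : Tendsto N atTop atTop) : Tendsto (fun n => S n / N n) atTop (𝓝 0) := by
  set a : ℕ → ℝ := fun n => S n / N n with ha
  have ha1 : ∀ n, |a n| ≤ 1 := fun n => by
    rw [ha, abs_div, Nat.abs_cast]
    exact div_le_one_of_le₀ (hSN n) (Nat.cast_nonneg _)
  have he01 : ∀ n, e n = 0 ∨ e n = 1 := fun n => by have := he n; omega
  have hsq : Summable fun n => (e n : ℝ) * (1 / (N n + 1)) ^ 2 := by
    refine summable_of_sum_range_le (c := 2) (fun n => by positivity) fun k => ?_
    have h1 : ∀ n, (e n : ℝ) * (1 / (N n + 1)) ^ 2 ≤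
        2 / (N n + 1) - 2 / (N (n + 1) + 1) := fun n => by
      rw [hN]
      rcases he01 n with h | h <;> rw [h]
      · simp
      · push_cast
        rw [one_mul, div_sub_div _ _ (by positivity) (by positivity), div_pow, one_pow,
          div_le_div_iff₀ (by positivity) (by positivity)]
        have h0 : (0 : ℝ) ≤ N n := Nat.cast_nonneg _
        nlinarith [mul_nonneg h0 h0, mul_nonneg h0 (mul_nonneg h0 h0)]
    refine (Finset.sum_le_sum fun n _ => h1 n).trans ?_
    rw [Finset.sum_range_sub' fun n => (2 : ℝ) / (N n + 1)]
    have h2 : (2 : ℝ) / (N 0 + 1) ≤ 2 := div_le_self zero_le_two (by simp)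
    have h3 : (0 : ℝ) ≤ 2 / (N k + 1) := by positivity
    linarith
  have hstep : ∀ n, dist (a n ^ 3) (a (n + 1) ^ 3) ≤
      9 * ((e n : ℝ) * (a n ^ 2 / (N n + 1))) + 24 * ((e n : ℝ) * (1 / (N n + 1)) ^ 2) := by
    intro n
    rw [dist_comm, Real.dist_eq]
    rcases he01 n with h | h
    · have h1 : S (n + 1) = S n := by
        have := hS n
        rw [h, Nat.cast_zero] at this
        exact sub_eq_zero.1 (abs_nonpos_iff.1 this)
      simp [ha, hN, h, h1]
    · have h0 : (0 : ℝ) ≤ N n := Nat.cast_nonneg _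
      -- The new average moves by `(g - a n) / (N n + 1)`, where `g` is the new term and both are at
      -- most `1` in absolute value.
      have h1 : |a (n + 1) - a n| ≤ 2 * (1 / (N n + 1)) := by
        have h2 : a (n + 1) - a n = ((S (n + 1) - S n) - a n) / (N n + 1) := by
          rw [ha]
          simp only [hN, h]
          push_cast
          rcases h0.eq_or_lt with h3 | h3
          · have h4 := hSN n
            rw [← h3] at h4
            rw [abs_nonpos_iff.1 h4]
            simp
          · field_simp
            ring
        rw [h2, abs_div, abs_of_pos (by positivity : (0 : ℝ) < N n + 1), mul_one_div]
        refine div_le_div_of_nonneg_right ?_ (by positivity)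
        have h5 := hS n
        rw [h, Nat.cast_one] at h5
        have h6 := abs_sub (S (n + 1) - S n) (a n)
        linarith [ha1 n]
      have h2 := abs_cube_sub_cube_le h1 (by positivity)
        (div_le_one_of_le₀ (by linarith) (by positivity))
      rw [h, Nat.cast_one, one_mul, one_mul]
      rwa [mul_one_div] at h2
  obtain ⟨l, hl⟩ := cauchySeq_tendsto_of_complete (cauchySeq_of_dist_le_of_summable _ hstep
    ((hsum.mul_left 9).add (hsq.mul_left 24)))
  -- Otherwise `a n ^ 2 ≥ |a n| ^ 3` stays away from zero, so `1 / (N + 1)` would be summable over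
  -- active times; but its partial sums dominate `log (N + 1)`, up to a constant.
  have hl0 : l = 0 := by
    by_contra hne
    have hpos : 0 < |l| / 2 := by have := abs_pos.2 hne; linarith
    have hev : ∀ᶠ n in atTop, |l| / 2 < |a n ^ 3| :=
      hl.abs.eventually_const_lt (by linarith)
    have hharm : Summable fun n => (e n : ℝ) * (1 / (N n + 1)) := by
      refine Summable.of_norm_bounded_eventually_nat (hsum.mul_left (|l| / 2)⁻¹) ?_
      filter_upwards [hev] with n hn
      have h1 : |l| / 2 ≤ a n ^ 2 := by
        rw [abs_pow] at hn
        rw [← sq_abs]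
        nlinarith [ha1 n, abs_nonneg (a n), sq_nonneg (|a n|)]
      rw [Real.norm_of_nonneg (by positivity), ← div_eq_inv_mul, le_div_iff₀ hpos]
      calc (e n : ℝ) * (1 / (N n + 1)) * (|l| / 2) ≤ (e n : ℝ) * (1 / (N n + 1)) * a n ^ 2 := by
            gcongr
        _ = (e n : ℝ) * (a n ^ 2 / (N n + 1)) := by ring
    have hlog : ∀ k, Real.log (N k + 1) - Real.log (N 0 + 1) ≤
        ∑' n, (e n : ℝ) * (1 / (N n + 1)) := by
      intro k
      refine le_trans ?_ (hharm.sum_le_tsum (Finset.range k) fun n _ => by positivity)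
      rw [← Finset.sum_range_sub fun n => Real.log (N n + 1)]
      refine Finset.sum_le_sum fun n _ => ?_
      rw [hN]
      rcases he01 n with h | h <;> rw [h]
      · simp
      · have h0 : (0 : ℝ) < N n + 1 := by positivity
        push_cast
        rw [← Real.log_div (by positivity) h0.ne', one_mul]
        refine (Real.log_le_sub_one_of_pos (by positivity)).trans (le_of_eq ?_)
        field_simp
        ring
    have hinf : Tendsto (fun k => Real.log ((N k : ℝ) + 1)) atTop atTop :=
      Real.tendsto_log_atTop.comp
        (tendsto_atTop_add_const_right _ _ (tendsto_natCast_atTop_atTop.comp htop))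
    obtain ⟨k, hk⟩ := (hinf.eventually_gt_atTop
      (∑' n, (e n : ℝ) * (1 / (N n + 1)) + Real.log (N 0 + 1))).exists
    linarith [hlog k]
  rw [hl0] at hl
  rw [Metric.tendsto_atTop] at hl ⊢
  intro ε hε
  obtain ⟨n₀, hn₀⟩ := hl (ε ^ 3) (by positivity)
  refine ⟨n₀, fun n hn => ?_⟩
  have := hn₀ n hn
  rw [Real.dist_0_eq_abs, abs_pow] at this
  rw [Real.dist_0_eq_abs]
  exact lt_of_pow_lt_pow_left₀ 3 hε.le this

theorem EReal.coe_sum {ι : Type*} (s : Finset ι) (f : ι → ℝ) :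
    ((∑ i ∈ s, f i : ℝ) : EReal) = ∑ i ∈ s, (f i : EReal) :=
  map_sum (⟨⟨Real.toEReal, EReal.coe_zero⟩, EReal.coe_add⟩ : ℝ →+ EReal) f s

namespace Calibration

/-! ### From average scores to the calibration gap. -/

section Gap

variable {Ω : Type*} [Fintype Ω]

theorem card_activeStages (σ : Forecaster Ω) (R : CheckingRule Ω) (x : ℕ → Ω) (n : ℕ) :
    (activeStages σ R x n).card = activeCount R (history σ x n) := by
  classical
  induction n with
  | zero => simp [activeStages, history]
  | succ n ih =>
    rw [history, activeCount_concat, ← ih, activeStages, activeStages, Finset.range_add_one,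
      Finset.filter_insert]
    split_ifs with h <;> simp [h]

theorem totalScore_history (σ : Forecaster Ω) (R : CheckingRule Ω) (x : ℕ → Ω) (n : ℕ) :
    totalScore R (history σ x n) = ∑ m ∈ activeStages σ R x n,
      ((R.tested (history σ x m)).indicator 1 (x m) -
        prob (σ (history σ x m)) (R.tested (history σ x m) ∩ R.active (history σ x m)) /
          prob (σ (history σ x m)) (R.active (history σ x m))) := by
  classical
  induction n with
  | zero => simp [activeStages, history]
  | succ n ih =>
    rw [history, totalScore_concat, ih, activeStages, activeStages, Finset.range_add_one,
      Finset.filter_insert]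
    split_ifs with h
    · rw [Finset.sum_insert (by simp), add_comm, score, Set.indicator_of_mem h]
    · rw [score, Set.indicator_of_notMem h, add_zero]

/-- At an active stage the outcome lies in `U`, so a strictly positive forecast gives `p(U) > 0` and
the value `+∞` never occurs. -/
theorem gap_eq {σ : Forecaster Ω} (hσ : ∀ h x, 0 < (σ h).1 x) (R : CheckingRule Ω) (x : ℕ → Ω)
    (n : ℕ) : gap σ R x n = ENNReal.ofReal |averageScore R (history σ x n)| := by
  classical
  have h1 : predicted σ R x n = ((∑ m ∈ activeStages σ R x n,
      prob (σ (history σ x m)) (R.tested (history σ x m) ∩ R.active (history σ x m)) /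
        prob (σ (history σ x m)) (R.active (history σ x m))) / (activeStages σ R x n).card : ℝ) := by
    rw [predicted, EReal.coe_div, EReal.coe_sum]
    congr 1
    refine Finset.sum_congr rfl fun m hm => ?_
    rw [activeStages, Finset.mem_filter] at hm
    rw [condProb, if_neg (prob_pos (hσ _) hm.2).ne']
  have h2 : (({m ∈ activeStages σ R x n | x m ∈ R.tested (history σ x m)}.card : ℕ) : ℝ) =
      ∑ m ∈ activeStages σ R x n, (R.tested (history σ x m)).indicator (1 : Ω → ℝ) (x m) := by
    rw [Finset.card_filter]
    push_cast
    refine Finset.sum_congr rfl fun m _ => ?_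
    simp [Set.indicator_apply]
  rw [gap, h1, empirical, ← EReal.coe_sub, EReal.abs_def, h2, ← sub_div, ← Finset.sum_sub_distrib,
    ← totalScore_history, card_activeStages, averageScore]

theorem limsup_gap_le_zero {σ : Forecaster Ω} (hσ : ∀ h x, 0 < (σ h).1 x) {R : CheckingRule Ω}
    {x : ℕ → Ω} (hsum : Summable fun n => decrease R (history σ x n) (x n)) :
    limsup (fun n : ℕ => ((activeStages σ R x n).card : ℝ≥0∞) / (n : ℝ≥0∞) *
        gap σ R x n) atTop ≤ 0 ∧
      (Tendsto (fun n => (activeStages σ R x n).card) atTop atTop →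
        limsup (fun n => gap σ R x n) atTop ≤ 0) := by
  have hgap : Tendsto (fun n => (activeStages σ R x n).card) atTop atTop →
      Tendsto (fun n => gap σ R x n) atTop (𝓝 0) := by
    intro htop
    have h1 : Tendsto (fun n => averageScore R (history σ x n)) atTop (𝓝 0) := by
      refine tendsto_average_of_summable_sq (N := fun n => activeCount R (history σ x n))
        (S := fun n => totalScore R (history σ x n))
        (e := fun n => (R.active (history σ x n)).indicator 1 (x n)) ?_ ?_ ?_ ?_ ?_ ?_
      · exact fun n => Set.indicator_le_self' (fun _ _ => zero_le_one) _
      · exact fun n => activeCount_concat _ _ _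
      · intro n
        simp only [history, totalScore_concat, add_sub_cancel_left]
        by_cases h : x n ∈ R.active (history σ x n)
        · simpa [h] using abs_score_le_one _ _ _ _
        · simp [h, score]
      · exact fun n => abs_totalScore_le _ _
      · refine hsum.congr fun n => ?_
        by_cases h : x n ∈ R.active (history σ x n) <;> simp [decrease, averageScore, h]
      · simpa only [card_activeStages] using htop
    simp_rw [gap_eq hσ]
    simpa using ENNReal.tendsto_ofReal h1.abs
  refine ⟨?_, fun htop => (hgap htop).limsup_eq.le⟩
  have hmono : Monotone fun n => (activeStages σ R x n).card := by
    classical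
    exact fun i j hij => Finset.card_le_card (Finset.filter_subset_filter _
      (Finset.range_subset_range.2 hij))
  refine Tendsto.limsup_eq ?_ |>.le
  -- Either the gap tends to zero and its factor is at most `1`, or the gap is at most `1` and its
  -- factor is at most `l / n`.
  rcases tendsto_atTop_of_monotone hmono with htop | ⟨l, hl⟩
  · refine tendsto_of_tendsto_of_tendsto_of_le_of_le tendsto_const_nhds (hgap htop)
      (fun _ => zero_le) fun n => ?_
    refine mul_le_of_le_one_left' (ENNReal.div_le_of_le_mul ?_)
    rw [one_mul]
    classical
    exact_mod_cast (Finset.card_filter_le _ _).trans (Finset.card_range n).le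
  · have hbound : ∀ n, ((activeStages σ R x n).card : ℝ≥0∞) / (n : ℝ≥0∞) * gap σ R x n ≤
        (l : ℝ≥0∞) / n := by
      intro n
      have h1 : (activeStages σ R x n).card ≤ l := hmono.ge_of_tendsto hl n
      have h2 : gap σ R x n ≤ 1 := by
        rw [gap_eq hσ, ← ENNReal.ofReal_one]
        exact ENNReal.ofReal_le_ofReal (abs_averageScore_le_one _ _)
      refine (mul_le_of_le_one_right' h2).trans ?_
      gcongr
    refine tendsto_of_tendsto_of_tendsto_of_le_of_le tendsto_const_nhds ?_
      (fun _ => zero_le) hbound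
    simpa using ENNReal.Tendsto.const_div ENNReal.tendsto_nat_nhds_top
      (Or.inr (ENNReal.natCast_ne_top l))

end Gap

end Calibration

/-! ### The calibration theorem. -/

instance {Ω : Type*} [Fintype Ω] [MeasurableSpace Ω] [MeasurableSingletonClass Ω]
    (σ : Calibration.Forecaster Ω) (τ : Calibration.Nature Ω) :
    IsProbabilityMeasure (Calibration.playMeasure σ τ) := by
  unfold Calibration.playMeasure
  infer_instance

theorem mainTheorem10 {Ω : Type*} [Fintype Ω] [Nonempty Ω] [MeasurableSpace Ω]
    [MeasurableSingletonClass Ω] [m : MeasurableSpace (Calibration.CheckingRule Ω)]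
    (hm : Calibration.cylinderSigmaAlgebra Ω ≤ m)
    (μ : Measure (Calibration.CheckingRule Ω)) [IsProbabilityMeasure μ] :
    ∃ σ : Calibration.Forecaster Ω, ∀ τ : Calibration.Nature Ω,
      ∀ᵐ R ∂μ, ∀ᵐ x ∂(Calibration.playMeasure σ τ),
        limsup (fun n : ℕ => ((Calibration.activeStages σ R x n).card : ℝ≥0∞) / (n : ℝ≥0∞) *
            Calibration.gap σ R x n) atTop ≤ 0 ∧
        (Tendsto (fun n => (Calibration.activeStages σ R x n).card) atTop atTop →
          limsup (fun n => Calibration.gap σ R x n) atTop ≤ 0) := by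
  obtain ⟨σ, hpos, hσ⟩ := Calibration.exists_forecaster_integral_weight_mul_score_le μ hm
  refine ⟨σ, fun τ => ?_⟩
  filter_upwards [Calibration.ae_ae_summable_decrease μ hm hσ (Calibration.playMeasure σ τ)]
    with R hR
  filter_upwards [hR] with x hx
  exact Calibration.limsup_gap_le_zero hpos hx
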